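/- Let $A\in\{0,1\}^{N\times n}$. For $d\ge 1$ let $\mathsf m^{rd}(d,A)$ be the supremum of all $m\ge 0$ for which there are unit vectors $U_1,\dots,U_N,V_1,\dots,V_n\in\mathbb R^d$ with $\langle U_j,V_i\rangle\ge m$ whenever $A_{ji}=1$ and $\langle U_j,V_i\rangle\le -m$ whenever $A_{ji}=0$ (and $-\infty$ if there is no such $m$). For an integer $d\ge1$ put $r=r(d)=\left\lfloor\frac{\sqrt{8d-7}-1}{2}\right\rfloor$. (1) There are absolute constants $c,C>0$ such that the following holds for all integers $k,n,N,d$ with $2\le k<n$, $N\ge 1$ and $d\ge \frac{k^2+5k+7}{2}$. There is a real number $\Delta\in(0,1]$, depending only on $k,n,N,d$, with $$c\,\frac{r-k}{r}\Big(\frac{1}{(n-k)N}\Big)^{\frac{2}{r-k}}\le\Delta\le C\,\frac{r-k}{r}\Big(\frac{1}{(n-k)N}\Big)^{\frac{2}{r-k}},$$ such that every $A\in\{0,1\}^{N\times n}$ with exactly $k$ ones in each row satisfies $$\mathsf m^{rd}(d,A)\ge\frac{\Delta}{2(\sqrt k+1)-\Delta}.$$ (2) $r(d)=\sqrt{2d}+O(1)$: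 there is an absolute constant $K$ with $|r(d)-\sqrt{2d}|\le K$ for all $d\ge 1$. (3) Consequently, any inverse polynomial loss in $n$ is achieved in dimension $\Theta(k^2)$: for every $\varepsilon>0$ there are $c,C>0$ depending only on $\varepsilon$ such that for all integers $2\le k<n$, $N\ge0$, all $d\ge Ck^2$ and every $A\in\{0,1\}^{N\times n}$ with exactly $k$ ones in each row, $\mathsf m^{rd}(d,A)\ge c\,k^{-1/2}n^{-\varepsilon}$ (for $N=0$, where the constraints are vacuous, $\mathsf m^{rd}(d,A)=+\infty$). -/

import Mathlib

noncomputable section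

/-- `U` and `V` are unit vectors in `ℝ^d` forming a margin-`m`, relative-bias-`τ` embedding
of the `0/1` matrix `A` (queries index rows, documents index columns). -/
structure IsMarginEmbedding {N n d : ℕ} (A : Matrix (Fin N) (Fin n) (Fin 2)) (m τ : ℝ)
    (U : Fin N → EuclideanSpace ℝ (Fin d)) (V : Fin n → EuclideanSpace ℝ (Fin d)) : Prop where
  norm_query : ∀ j, ‖U j‖ = 1
  norm_document : ∀ i, ‖V i‖ = 1
  margin_nonneg : 0 ≤ m
  le_of_relevant : ∀ j i, A j i = 1 → τ + m ≤ inner ℝ (U j) (V i)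
  le_of_irrelevant : ∀ j i, A j i = 0 → inner ℝ (U j) (V i) ≤ τ - m

/-- The optimal restricted-dimension margin: the supremum of all `m ≥ 0` such that `A` has a
margin-`m`, relative-bias-`0` embedding in dimension `d`.  It is taken in the extended reals, so
it equals `⊥ = -∞` when there is no such embedding for any `m ≥ 0`. -/
def restrictedMargin {N n : ℕ} (d : ℕ) (A : Matrix (Fin N) (Fin n) (Fin 2)) : EReal :=
  sSup {x : EReal | ∃ m : ℝ, x = (m : EReal) ∧
    ∃ (U : Fin N → EuclideanSpace ℝ (Fin d)) (V : Fin n → EuclideanSpace ℝ (Fin d)),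
      IsMarginEmbedding A m 0 U V}

/-- Every row of `A` has exactly `k` ones. -/
def HasRowWeight {N n : ℕ} (A : Matrix (Fin N) (Fin n) (Fin 2)) (k : ℕ) : Prop :=
  ∀ j, (Finset.univ.filter (fun i => A j i = 1)).card = k

/-- `r = ⌊(√(8d - 7) - 1) / 2⌋`. -/
def liftDim (d : ℕ) : ℕ := ⌊(Real.sqrt (8 * (d : ℝ) - 7) - 1) / 2⌋₊

/-- `((r - k) / r) * (1 / ((n - k) N)) ^ (2 / (r - k))` with `r = ⌊(√(8d - 7) - 1) / 2⌋`,
all operations being those of the real numbers. -/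
def gapRate (k n N d : ℕ) : ℝ :=
  (((liftDim d : ℝ) - k) / (liftDim d : ℝ)) *
    (1 / (((n : ℝ) - k) * N)) ^ (2 / ((liftDim d : ℝ) - k))

end

/-! Represent the columns by unit vectors `v i` in `ℝ^r`, and a row with support `S` by the span `K`
of the `v s`, `s ∈ S`. The squared norm of the projection of `v i` to `K` is 1 for `i ∈ S`, and at
most `1 - Δ` for `i ∉ S` if `v i` has squared distance at least `Δ` from `K`. It is linear in `v
vᵀ`, so symmetric `r × r` matrices plus one coordinate for the threshold `1 - Δ/2` separate the two
cases in dimension `r(r+1)/2 + 1`. The projection has squared Frobenius norm at most `k`; this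
bounds the loss from normalising (`exists_marginEmbedding`).

Gaussian directions supply the `v i`: a small-ball estimate (`gaussProb_orthogonal_small`) and a
union bound over pairs `(S, i)` give `exists_unit_vectors_far_from_spans`. For polynomial loss, the
number of distinct supports is at most `n ^ k` whatever `N` is. -/

open MeasureTheory

/-! ### Gaussian small-ball estimates by linear change of variables -/

section Gaussian

variable {E : Type*} [NormedAddCommGroup E]

/-- The unnormalised Gaussian weight `exp (-‖v‖²)`. -/
noncomputable def gaussWeight (v : E) : ENNReal := ENNReal.ofReal (Real.exp (-‖v‖ ^ 2))

theorem measurable_gaussWeight [MeasurableSpace E] [BorelSpace E] :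
    Measurable (gaussWeight (E := E)) := by
  unfold gaussWeight; fun_prop

variable [InnerProductSpace ℝ E] [FiniteDimensional ℝ E]

/-- The linear map that scales `K` by `x` and its orthogonal complement by `y`. -/
noncomputable def scaleAlong (K : Submodule ℝ E) (x y : ℝ) : E →ₗ[ℝ] E :=
  x • (K.starProjection : E →ₗ[ℝ] E) + y • (Kᗮ.starProjection : E →ₗ[ℝ] E)

theorem scaleAlong_apply (K : Submodule ℝ E) (x y : ℝ) (v : E) :
    scaleAlong K x y v = x • K.starProjection v + y • Kᗮ.starProjection v := rfl

theorem norm_sq_scaleAlong (K : Submodule ℝ E) (x y : ℝ) (v : E) :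
    ‖scaleAlong K x y v‖ ^ 2 =
      x ^ 2 * ‖K.starProjection v‖ ^ 2 + y ^ 2 * ‖Kᗮ.starProjection v‖ ^ 2 := by
  have h : inner ℝ (x • K.starProjection v) (y • Kᗮ.starProjection v) = 0 :=
    Submodule.inner_right_of_mem_orthogonal
      (K.smul_mem _ (K.starProjection_apply_mem v))
      (Kᗮ.smul_mem _ (Kᗮ.starProjection_apply_mem v))
  rw [scaleAlong_apply, pow_two, norm_add_sq_eq_norm_sq_add_norm_sq_real h, norm_smul, norm_smul]
  have hx := sq_abs x
  have hy := sq_abs y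
  simp only [Real.norm_eq_abs]
  linear_combination ‖K.starProjection v‖ ^ 2 * hx + ‖Kᗮ.starProjection v‖ ^ 2 * hy

theorem det_scaleAlong (K : Submodule ℝ E) (x y : ℝ) :
    LinearMap.det (scaleAlong K x y) =
      x ^ Module.finrank ℝ K * y ^ Module.finrank ℝ Kᗮ := by
  have h := K.isCompl_orthogonal
  set e := Submodule.prodEquivOfIsCompl K Kᗮ h
  have key : scaleAlong K x y =
      (e : (K × Kᗮ) →ₗ[ℝ] E) ∘ₗ ((x • LinearMap.id).prodMap (y • LinearMap.id)) ∘ₗ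
        (e.symm : E →ₗ[ℝ] K × Kᗮ) := by
    ext v
    obtain ⟨⟨a, b⟩, rfl⟩ := e.surjective v
    have ha : K.starProjection (a : E) = a := K.starProjection_eq_self_iff.2 a.2
    have hb' : K.starProjection (b : E) = 0 := by
      rw [Submodule.starProjection_apply_eq_zero_iff]; exact b.2
    simp [scaleAlong_apply, e, ha, hb']
  rw [key, LinearMap.det_conj, LinearMap.det_prodMap, LinearMap.det_smul, LinearMap.det_smul]
  simp

variable [MeasurableSpace E] [BorelSpace E]

theorem lintegral_gaussWeight_ne_top : ∫⁻ v : E, gaussWeight v ≠ ⊤ := by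
  have h : Integrable (fun v : E => Real.exp (-‖v‖ ^ 2)) := by
    refine Integrable.of_integral_ne_zero ?_
    have := GaussianFourier.integral_rexp_neg_mul_sq_norm (V := E) one_pos
    simp only [neg_mul, one_mul] at this
    rw [this]
    positivity
  exact h.lintegral_lt_top.ne

theorem lintegral_gaussWeight_ne_zero : ∫⁻ v : E, gaussWeight v ≠ 0 := by
  have h : Function.support (gaussWeight (E := E)) = Set.univ := by
    ext v; simp [gaussWeight, Real.exp_pos]
  rw [← pos_iff_ne_zero, lintegral_pos_iff_support measurable_gaussWeight, h]
  exact Measure.measure_univ_pos.2 (NeZero.ne _)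

theorem lintegral_gaussWeight_comp (f : E →ₗ[ℝ] E) (hf : LinearMap.det f ≠ 0) :
    ∫⁻ v, gaussWeight (f v) =
      ENNReal.ofReal |(LinearMap.det f)⁻¹| * ∫⁻ v : E, gaussWeight v := by
  have hm : Measurable f := f.continuous_of_finiteDimensional.measurable
  rw [← lintegral_map measurable_gaussWeight hm,
    Measure.map_linearMap_addHaar_eq_smul_addHaar _ hf, lintegral_smul_measure, smul_eq_mul]

variable (E) in
/-- The Gaussian probability measure with density proportional to `exp (-‖v‖²)`. -/
noncomputable def gaussProb : Measure E :=
  (∫⁻ v : E, gaussWeight v)⁻¹ • (volume : Measure E).withDensity gaussWeight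

instance : IsProbabilityMeasure (gaussProb E) := ⟨by
  rw [gaussProb, Measure.smul_apply, withDensity_apply _ MeasurableSet.univ, Measure.restrict_univ,
    smul_eq_mul, ENNReal.inv_mul_cancel lintegral_gaussWeight_ne_zero lintegral_gaussWeight_ne_top]⟩

theorem gaussProb_singleton [Nontrivial E] (v : E) : gaussProb E {v} = 0 := by
  have : (volume : Measure E).withDensity gaussWeight {v} = 0 :=
    withDensity_absolutelyContinuous _ _ (measure_singleton v)
  simp [gaussProb, this]

/-- Gaussian mass of a region on which the linear map `f` does not increase the norm. -/
theorem gaussProb_le_of_norm_le (f : E →ₗ[ℝ] E) (hf : LinearMap.det f ≠ 0) {s : Set E}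
    (hs : ∀ v ∈ s, ‖f v‖ ≤ ‖v‖) (hsm : MeasurableSet s) :
    gaussProb E s ≤ ENNReal.ofReal |(LinearMap.det f)⁻¹| := by
  have h1 : ∫⁻ v in s, gaussWeight v ≤ ∫⁻ v, gaussWeight (f v) := by
    refine (setLIntegral_mono' hsm fun v hv => ?_).trans (setLIntegral_le_lintegral s _)
    have := hs v hv
    unfold gaussWeight
    gcongr
  rw [lintegral_gaussWeight_comp f hf] at h1
  rw [gaussProb, Measure.smul_apply, withDensity_apply _ hsm, smul_eq_mul,
    ENNReal.inv_mul_le_iff lintegral_gaussWeight_ne_zero lintegral_gaussWeight_ne_top, mul_comm]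
  exact h1

/-- Small-ball bound for the component of a Gaussian vector orthogonal to a subspace. -/
theorem gaussProb_orthogonal_small (K : Submodule ℝ E) {k q : ℕ} (hk : 0 < k)
    (hr : Module.finrank ℝ E = k + q) (hK : Module.finrank ℝ K ≤ k) {β : ℝ} (h0 : 0 < β)
    (h1 : β ≤ 1) :
    gaussProb E {v | ‖Kᗮ.starProjection v‖ ^ 2 ≤ β * (q / (k + q)) * ‖v‖ ^ 2} ≤
      ENNReal.ofReal ((Real.exp 1 * β) ^ ((q : ℝ) / 2)) := by
  have hk' : (0 : ℝ) < k := by exact_mod_cast hk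
  -- A Chernoff-type choice: shrink `K` by `√X` and stretch its complement by `β^(-1/2)`. On the
  -- event the norm does not grow, and the inverse determinant is at most `(eβ)^(q/2)` since `X⁻¹ =
  -- 1 + q/k ≤ exp (q/k)`.
  set X : ℝ := k / (k + q) with hX
  have hX0 : 0 < X := by positivity
  have hX1 : X ≤ 1 := by rw [hX, div_le_one (by positivity)]; simp
  have hq : (q : ℝ) / (k + q) = 1 - X := by rw [hX]; field_simp; ring
  set x := Real.sqrt X
  set y := Real.sqrt β⁻¹
  have hx2 : x ^ 2 = X := Real.sq_sqrt hX0.le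
  have hy2 : y ^ 2 = β⁻¹ := Real.sq_sqrt (by positivity)
  have hx0 : 0 < x := Real.sqrt_pos.2 hX0
  have hy0 : 0 < y := Real.sqrt_pos.2 (by positivity)
  have hdet := det_scaleAlong K x y
  have hfr := K.finrank_add_finrank_orthogonal
  have hpos : 0 < LinearMap.det (scaleAlong K x y) := by rw [hdet]; positivity
  refine (gaussProb_le_of_norm_le (scaleAlong K x y) hpos.ne' (fun v hv => ?_) ?_).trans ?_
  · simp only [Set.mem_ofPred_eq] at hv
    rw [← sq_le_sq₀ (norm_nonneg _) (norm_nonneg _), norm_sq_scaleAlong, hx2, hy2]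
    rw [K.norm_sq_eq_add_norm_sq_starProjection v] at hv ⊢
    rw [hq] at hv
    set a := ‖K.starProjection v‖ ^ 2
    set b := ‖Kᗮ.starProjection v‖ ^ 2
    have hb0 : 0 ≤ b := sq_nonneg _
    have : β⁻¹ * b ≤ (1 - X) * (a + b) := by
      rw [inv_mul_le_iff₀ h0]; linarith
    nlinarith
  · exact (isClosed_le (by fun_prop) (by fun_prop)).measurableSet
  · apply ENNReal.ofReal_le_ofReal
    rw [abs_of_pos (by positivity), hdet]
    have hx1 : x ≤ 1 := Real.sqrt_le_one.2 hX1
    have hy1 : 1 ≤ y := Real.one_le_sqrt.2 ((one_le_inv₀ h0).2 h1)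
    have h2 : x ^ k * y ^ q ≤ x ^ Module.finrank ℝ K * y ^ Module.finrank ℝ Kᗮ :=
      mul_le_mul (pow_le_pow_of_le_one hx0.le hx1 hK) (pow_le_pow_right₀ hy1 (by omega))
        (by positivity) (by positivity)
    refine (inv_anti₀ (by positivity) h2).trans ?_
    rw [← sq_le_sq₀ (by positivity) (by positivity), ← Real.rpow_natCast (_ ^ ((q : ℝ) / 2)) 2,
      ← Real.rpow_mul (by positivity)]
    have h3 : (q : ℝ) / 2 * (2 : ℕ) = q := by push_cast; ring
    rw [h3, Real.rpow_natCast, inv_pow, mul_pow, ← pow_mul, ← pow_mul, mul_comm k, mul_comm q,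
      pow_mul, pow_mul, hx2, hy2, mul_inv, inv_pow, inv_inv, mul_pow]
    gcongr
    have h4 : X⁻¹ ≤ Real.exp (q / k) := by
      have := Real.add_one_le_exp ((q : ℝ) / k)
      have h5 : X⁻¹ = q / k + 1 := by rw [hX]; field_simp; ring
      linarith
    rw [← inv_pow]
    calc X⁻¹ ^ k ≤ Real.exp (q / k) ^ k := by gcongr
      _ = Real.exp 1 ^ q := by
        rw [← Real.exp_nat_mul, ← Real.exp_nat_mul]; congr 1; field_simp

end Gaussian

/-! ### Random vectors far from spans -/

section RandomVectors

variable {E : Type*} [NormedAddCommGroup E] [InnerProductSpace ℝ E]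

/-- The configurations for which `v i` is relatively close to the span of `v s`, `s ∈ S`. -/
def nearSpan {n : ℕ} (a : ℝ) (S : Finset (Fin n)) (i : Fin n) : Set (Fin n → E) :=
  {v | ∃ c : Fin n → ℝ, ‖v i - ∑ s ∈ S, c s • v s‖ ^ 2 < a * ‖v i‖ ^ 2}

theorem isOpen_nearSpan {n : ℕ} (a : ℝ) (S : Finset (Fin n)) (i : Fin n) :
    IsOpen (nearSpan (E := E) a S i) := by
  have : nearSpan (E := E) a S i =
      ⋃ c : Fin n → ℝ, {v | ‖v i - ∑ s ∈ S, c s • v s‖ ^ 2 < a * ‖v i‖ ^ 2} := by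
    ext v; simp [nearSpan]
  rw [this]
  exact isOpen_iUnion fun c => isOpen_lt (by fun_prop) (by fun_prop)

theorem exists_unit_of_notMem_nearSpan {n : ℕ} {a : ℝ} (v : Fin n → E) (hv : ∀ i, v i ≠ 0) :
    ∃ w : Fin n → E, (∀ i, ‖w i‖ = 1) ∧ ∀ S i, v ∉ nearSpan a S i →
      ∀ c : Fin n → ℝ, a ≤ ‖w i - ∑ s ∈ S, c s • w s‖ ^ 2 := by
  refine ⟨fun i => ‖v i‖⁻¹ • v i, fun i => norm_smul_inv_norm (𝕜 := ℝ) (hv i), fun S i h c => ?_⟩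
  have hi := norm_pos_iff.2 (hv i)
  have h2 := not_lt.1 (not_exists.1 h fun s => ‖v i‖ * c s * ‖v s‖⁻¹)
  have h3 : v i - ∑ s ∈ S, (‖v i‖ * c s * ‖v s‖⁻¹) • v s =
      ‖v i‖ • (‖v i‖⁻¹ • v i - ∑ s ∈ S, c s • ‖v s‖⁻¹ • v s) := by
    rw [smul_sub, smul_inv_smul₀ hi.ne', Finset.smul_sum]
    simp only [smul_smul, mul_assoc]
  rw [h3, norm_smul, norm_norm, mul_pow, mul_comm] at h2
  exact le_of_mul_le_mul_left h2 (by positivity)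

variable [FiniteDimensional ℝ E]

theorem norm_orthogonal_starProjection_le (K : Submodule ℝ E) (x : E) {y : E} (hy : y ∈ K) :
    ‖Kᗮ.starProjection x‖ ≤ ‖x - y‖ := by
  have h : Kᗮ.starProjection y = 0 := by
    rw [Submodule.starProjection_apply_eq_zero_iff, Submodule.orthogonal_orthogonal]; exact hy
  calc ‖Kᗮ.starProjection x‖ = ‖Kᗮ.starProjection (x - y)‖ := by rw [map_sub, h, sub_zero]
    _ ≤ ‖x - y‖ := Submodule.norm_starProjection_apply_le _ _

variable [MeasurableSpace E] [BorelSpace E]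

/-- By Fubini, freeze all vectors except `v i`. As `i ∉ S`, the span is then a fixed subspace of
dimension at most `k`, and the small-ball bound applies. -/
theorem pi_gaussProb_nearSpan {n k q : ℕ} (hk : 0 < k) (hr : Module.finrank ℝ E = k + q) {β : ℝ}
    (h0 : 0 < β) (h1 : β ≤ 1) {S : Finset (Fin n)} (hS : S.card ≤ k) {i : Fin n} (hi : i ∉ S) :
    Measure.pi (fun _ : Fin n => gaussProb E) (nearSpan (β * (q / (k + q))) S i) ≤
      ENNReal.ofReal ((Real.exp 1 * β) ^ ((q : ℝ) / 2)) := by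
  obtain _ | n := n
  · exact i.elim0
  have hmp := measurePreserving_piFinSuccAbove (fun _ : Fin (n + 1) => gaussProb E) i
  set e := MeasurableEquiv.piFinSuccAbove (fun _ : Fin (n + 1) => E) i
  rw [← hmp.symm.measure_preimage_equiv, Measure.prod_apply_symm
    (e.symm.measurable (isOpen_nearSpan _ S i).measurableSet)]
  refine (lintegral_mono (g := fun _ => ENNReal.ofReal ((Real.exp 1 * β) ^ ((q : ℝ) / 2)))
    fun w => ?_).trans (by simp)
  set f : Fin (n + 1) → E := i.insertNth 0 w
  set K := Submodule.span ℝ (f '' S)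
  have hK : Module.finrank ℝ K ≤ k := by
    classical
    have := finrank_span_finset_le_card (R := ℝ) (S.image f)
    rw [Finset.coe_image] at this
    exact this.trans (Finset.card_image_le.trans hS)
  refine (measure_mono fun x hx => ?_).trans (gaussProb_orthogonal_small K hk hr hK h0 h1)
  obtain ⟨c, hc⟩ := hx
  have he : e.symm (x, w) = i.insertNth x w := rfl
  have hxi : e.symm (x, w) i = x := by simp [he]
  have hxs : ∀ s ∈ S, e.symm (x, w) s = f s := by
    intro s hs
    have hsi : s ≠ i := fun h => hi (h ▸ hs)
    obtain ⟨t, rfl⟩ := Fin.exists_succAbove_eq hsi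
    simp [he, f]
  rw [hxi, Finset.sum_congr rfl fun s hs => by rw [hxs s hs]] at hc
  have hmem : ∑ s ∈ S, c s • f s ∈ K := K.sum_mem fun s hs =>
    K.smul_mem _ (Submodule.subset_span (Set.mem_image_of_mem f hs))
  have := norm_orthogonal_starProjection_le K x hmem
  exact (pow_le_pow_left₀ (norm_nonneg _) this 2).trans hc.le

/-- Random unit vectors, every one of which is far from the spans of the sets of a family. -/
theorem exists_unit_vectors_far_from_spans {n k q : ℕ} (hk : 0 < k) (hq : 0 < q)
    (hr : Module.finrank ℝ E = k + q) (F : Finset (Finset (Fin n))) (hF : ∀ S ∈ F, S.card = k)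
    {M : ℝ} (hM : 1 ≤ M) (hFM : F.card * ((n : ℝ) - k) ≤ M) :
    ∃ v : Fin n → E, (∀ i, ‖v i‖ = 1) ∧ ∀ S ∈ F, ∀ i ∉ S, ∀ c : Fin n → ℝ,
      1 / 4 * (q / (k + q) * (1 / M) ^ (2 / (q : ℝ))) ≤ ‖v i - ∑ s ∈ S, c s • v s‖ ^ 2 := by
  have hq' : (0 : ℝ) < q := by exact_mod_cast hq
  -- The factor `1/4` is below `1/e`, so each bad event has probability strictly less than `1/M`.
  set β : ℝ := 1 / 4 * (1 / M) ^ (2 / (q : ℝ)) with hβ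
  have hM0 : 0 < M := by linarith
  have hβ0 : 0 < β := by positivity
  have hβ1 : β ≤ 1 := by
    have : (1 / M) ^ (2 / (q : ℝ)) ≤ 1 :=
      Real.rpow_le_one (by positivity) ((div_le_one hM0).2 hM) (by positivity)
    linarith
  set P := Measure.pi (fun _ : Fin n => gaussProb E)
  set δ := (Real.exp 1 * β) ^ ((q : ℝ) / 2) with hδ
  have hδM : δ < 1 / M := by
    have h1 : ((1 / M) ^ (2 / (q : ℝ))) ^ ((q : ℝ) / 2) = 1 / M := by
      rw [← Real.rpow_mul (by positivity), div_mul_div_comm, mul_comm, div_self (by positivity),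
        Real.rpow_one]
    rw [hδ, hβ, ← mul_assoc, Real.mul_rpow (by positivity) (by positivity), h1]
    have h2 : (Real.exp 1 * (1 / 4)) ^ ((q : ℝ) / 2) < 1 :=
      Real.rpow_lt_one (by positivity) (by linarith [Real.exp_one_lt_d9]) (by positivity)
    exact mul_lt_of_lt_one_left (by positivity) h2
  set B : Set (Fin n → E) :=
    (⋃ S ∈ F, ⋃ i ∈ Sᶜ, nearSpan (β * (q / (k + q))) S i) ∪ ⋃ i, {v | v i = 0}
  have hB : P B < 1 := by
    have hz : P (⋃ i, {v | v i = 0}) = 0 := by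
      have : Nontrivial E := Module.finrank_pos_iff (R := ℝ).1 (by omega)
      refine measure_iUnion_null fun i => ?_
      have := (measurePreserving_eval (fun _ : Fin n => gaussProb E) i).measure_preimage
        (measurableSet_singleton (0 : E)).nullMeasurableSet
      rw [gaussProb_singleton] at this
      exact this
    have hu : P (⋃ S ∈ F, ⋃ i ∈ Sᶜ, nearSpan (β * (q / (k + q))) S i) ≤
        ∑ S ∈ F, ∑ i ∈ Sᶜ, ENNReal.ofReal δ := by
      refine (measure_biUnion_finset_le _ _).trans (Finset.sum_le_sum fun S hS => ?_)
      refine (measure_biUnion_finset_le _ _).trans (Finset.sum_le_sum fun i hi => ?_)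
      exact pi_gaussProb_nearSpan hk hr hβ0 hβ1 (hF S hS).le (Finset.mem_compl.1 hi)
    refine (measure_union_le _ _).trans_lt ?_
    rw [hz, add_zero]
    refine hu.trans_lt ?_
    simp_rw [← ENNReal.ofReal_sum_of_nonneg (fun _ _ => show 0 ≤ δ by positivity)]
    rw [← ENNReal.ofReal_sum_of_nonneg (fun _ _ => Finset.sum_nonneg fun _ _ => by positivity),
      ENNReal.ofReal_lt_one]
    have h3 : ∀ S ∈ F, ∑ i ∈ Sᶜ, δ = (n - k) * δ := by
      intro S hS
      rw [Finset.sum_const, Finset.card_compl, hF S hS, Fintype.card_fin, nsmul_eq_mul,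
        Nat.cast_sub ((hF S hS) ▸ (Finset.card_le_univ S).trans_eq (Fintype.card_fin n))]
    rw [Finset.sum_congr rfl h3, Finset.sum_const, nsmul_eq_mul, ← mul_assoc]
    calc F.card * ((n : ℝ) - k) * δ ≤ M * δ := by gcongr
      _ < M * (1 / M) := by gcongr
      _ = 1 := by field_simp
  obtain ⟨v, hv⟩ : ∃ v, v ∉ B := by
    by_contra! h
    rw [Set.eq_univ_of_forall h, measure_univ] at hB
    exact lt_irrefl _ hB
  simp only [B, Set.mem_union, Set.mem_iUnion, not_or, not_exists] at hv
  obtain ⟨w, hw, hw'⟩ := exists_unit_of_notMem_nearSpan (a := β * (q / (k + q))) v hv.2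
  refine ⟨w, hw, fun S hS i hi c => ?_⟩
  have := hw' S i (hv.1 S hS i (Finset.mem_compl.2 hi)) c
  refine le_trans (le_of_eq ?_) this
  rw [hβ]; ring

end RandomVectors

/-! ### From subspaces to a margin embedding -/

section Embedding

variable {E F : Type*} [NormedAddCommGroup E] [InnerProductSpace ℝ E] [FiniteDimensional ℝ E]
  [NormedAddCommGroup F] [InnerProductSpace ℝ F]

variable (E) in
theorem exists_linearIsometry_euclideanSpace {d : ℕ} (h : Module.finrank ℝ E ≤ d) :
    Nonempty (E →ₗᵢ[ℝ] EuclideanSpace ℝ (Fin d)) := by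
  set b := stdOrthonormalBasis ℝ E
  set f : E →ₗ[ℝ] EuclideanSpace ℝ (Fin d) :=
    b.toBasis.constr ℝ fun i => EuclideanSpace.basisFun (Fin d) ℝ (Fin.castLE h i)
  refine ⟨f.isometryOfOrthonormal (v := b.toBasis) (by simp) ?_⟩
  have : f ∘ b.toBasis = EuclideanSpace.basisFun (Fin d) ℝ ∘ Fin.castLE h := by
    ext1 i
    simp only [Function.comp_apply, f, Module.Basis.constr_basis]
  rw [this]
  exact (EuclideanSpace.basisFun (Fin d) ℝ).orthonormal.comp _ (Fin.castLE_injective h)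

/-- Symmetric `r × r` matrices with the Frobenius inner product. -/
noncomputable def symmMatrices (r : ℕ) : Submodule ℝ (EuclideanSpace ℝ (Fin r × Fin r)) where
  carrier := {x | ∀ i j, x (i, j) = x (j, i)}
  add_mem' hx hy i j := by simp [hx i j, hy i j]
  zero_mem' _ _ := rfl
  smul_mem' c x hx i j := by simp [hx i j]

/-- A symmetric matrix is a function on unordered pairs of indices. -/
theorem finrank_symmMatrices_le (r : ℕ) :
    Module.finrank ℝ (symmMatrices r) ≤ (r + 1).choose 2 := by
  let f : symmMatrices r →ₗ[ℝ] (Sym2 (Fin r) → ℝ) :=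
    { toFun := fun x z => Sym2.lift ⟨fun i j => (x : EuclideanSpace ℝ (Fin r × Fin r)) (i, j), x.2⟩ z
      map_add' := fun x y => by ext z; induction z; simp
      map_smul' := fun c x => by ext z; induction z; simp }
  have hf : Function.Injective f := by
    intro x y hxy
    ext ⟨i, j⟩
    simpa [f] using congrFun hxy s(i, j)
  refine (LinearMap.finrank_le_finrank_of_injective hf).trans_eq ?_
  rw [Module.finrank_fintype_fun_eq_card, ← Nat.card_eq_fintype_card, Sym2.natCard, Nat.card_fin]

/-- A map `v ↦ v vᵀ` squaring inner products. -/
theorem exists_inner_eq_inner_sq (r : ℕ) :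
    ∃ φ : EuclideanSpace ℝ (Fin r) → symmMatrices r,
      ∀ u v, inner ℝ (φ u) (φ v) = inner ℝ u v ^ 2 := by
  refine ⟨fun v => ⟨WithLp.toLp 2 fun p => v p.1 * v p.2, fun i j => mul_comm _ _⟩, fun u v => ?_⟩
  rw [Submodule.coe_inner]
  simp only [PiLp.inner_apply, RCLike.inner_apply, conj_trivial, Fintype.sum_prod_type, pow_two,
    Finset.sum_mul_sum]
  exact Finset.sum_congr rfl fun i _ => Finset.sum_congr rfl fun j _ => by ring

/-- If `φ` squares inner products, then the orthogonal projection to `K` has a representing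
vector of squared norm at most `dim K`. -/
theorem exists_inner_eq_norm_starProjection_sq {φ : E → F}
    (hφ : ∀ u v, inner ℝ (φ u) (φ v) = inner ℝ u v ^ 2) (K : Submodule ℝ E) :
    ∃ Q : F, ‖Q‖ ^ 2 = Module.finrank ℝ K ∧
      ∀ v, inner ℝ Q (φ v) = ‖K.starProjection v‖ ^ 2 := by
  set b := stdOrthonormalBasis ℝ K
  have hb : ∀ s t, inner ℝ (b s : E) (b t : E) = if s = t then 1 else 0 := fun s t => by
    rw [← Submodule.coe_inner]; exact orthonormal_iff_ite.1 b.orthonormal s t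
  refine ⟨∑ s, φ (b s), ?_, fun v => ?_⟩
  · rw [← real_inner_self_eq_norm_sq, sum_inner]
    simp [inner_sum, hφ, hb]
  · rw [sum_inner, Submodule.starProjection_apply, ← Submodule.coe_norm,
      ← b.sum_sq_norm_inner_right]
    refine Finset.sum_congr rfl fun s _ => ?_
    rw [hφ, Real.norm_eq_abs, sq_abs, Submodule.coe_inner,
      ← Submodule.starProjection_apply, ← K.inner_starProjection_left_eq_right,
      K.starProjection_eq_self_iff.2 (b s).2]

theorem exists_marginEmbedding {N n d r k : ℕ} (hd : (r + 1).choose 2 + 1 ≤ d) (hk : 0 < k)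
    (A : Matrix (Fin N) (Fin n) (Fin 2)) (hA : HasRowWeight A k)
    {v : Fin n → EuclideanSpace ℝ (Fin r)} (hv : ∀ i, ‖v i‖ = 1) {Δ : ℝ} (h0 : 0 < Δ) (h1 : Δ ≤ 1)
    (hfar : ∀ j, ∀ i, A j i = 0 → ∀ c : Fin n → ℝ,
      Δ ≤ ‖v i - ∑ s with A j s = 1, c s • v s‖ ^ 2) :
    ∃ (U : Fin N → EuclideanSpace ℝ (Fin d)) (V : Fin n → EuclideanSpace ℝ (Fin d)),
      IsMarginEmbedding A (Δ / (2 * (Real.sqrt k + 1) - Δ)) 0 U V := by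
  classical
  obtain ⟨φ, hφ⟩ := exists_inner_eq_inner_sq r
  set S : Fin N → Finset (Fin n) := fun j => Finset.univ.filter fun i => A j i = 1
  set K : Fin N → Submodule ℝ (EuclideanSpace ℝ (Fin r)) :=
    fun j => Submodule.span ℝ (v '' S j)
  have hK : ∀ j, Module.finrank ℝ (K j) ≤ k := fun j => by
    have := finrank_span_finset_le_card (R := ℝ) ((S j).image v)
    rw [Finset.coe_image] at this
    exact this.trans (Finset.card_image_le.trans (hA j).le)
  choose Q hQ hQv using fun j => exists_inner_eq_norm_starProjection_sq hφ (K j)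
  have hφn : ∀ i, ‖φ (v i)‖ ^ 2 = 1 := fun i => by
    rw [← real_inner_self_eq_norm_sq, hφ, real_inner_self_eq_norm_sq, hv]; norm_num
  have hin : ∀ j i, A j i = 1 → inner ℝ (Q j) (φ (v i)) = 1 := fun j i hji => by
    have : v i ∈ K j := Submodule.subset_span ⟨i, by simpa [S] using hji, rfl⟩
    rw [hQv, (K j).starProjection_eq_self_iff.2 this, hv]; norm_num
  have hout : ∀ j i, A j i = 0 → inner ℝ (Q j) (φ (v i)) ≤ 1 - Δ := fun j i hji => by
    obtain ⟨c, hc⟩ := (Submodule.mem_span_image_finset_iff_exists_fun' ℝ).1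
      ((K j).starProjection_apply_mem (v i))
    have h2 := hfar j i hji c
    rw [hc] at h2
    have h3 := (K j).norm_sq_eq_add_norm_sq_starProjection (v i)
    rw [Submodule.starProjection_orthogonal_val, hv] at h3
    rw [hQv]; linarith
  set ρ := Real.sqrt k
  have hρ : 0 < ρ := Real.sqrt_pos.2 (by exact_mod_cast hk)
  have hρ2 : ρ ^ 2 = k := Real.sq_sqrt (by positivity)
  set p := 1 - Δ / 2 with hp
  have hp0 : 0 < p := by linarith
  -- The extra coordinates `-t` and `s` contribute `-ts = -p`. The ratio `t/s = ρ` matches the norm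
  -- bounds `ρ` and `1` of the matrix parts, so the product of the norms is at most `ρ + p`, the
  -- equality case of Cauchy–Schwarz.
  set t := Real.sqrt (ρ * p)
  set s := Real.sqrt (p / ρ)
  have ht : t ^ 2 = ρ * p := Real.sq_sqrt (by positivity)
  have hs : s ^ 2 = p / ρ := Real.sq_sqrt (by positivity)
  have hts : t * s = p := by
    rw [← Real.sqrt_mul (by positivity), show ρ * p * (p / ρ) = p ^ 2 by field_simp,
      Real.sqrt_sq hp0.le]
  let X : Fin N → WithLp 2 (symmMatrices r × ℝ) := fun j => WithLp.toLp 2 (Q j, -t)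
  let Y : Fin n → WithLp 2 (symmMatrices r × ℝ) := fun i => WithLp.toLp 2 (φ (v i), s)
  have ht0 : 0 < t := Real.sqrt_pos.2 (by positivity)
  have hX : ∀ j, ‖X j‖ ^ 2 = Module.finrank ℝ (K j) + ρ * p := fun j => by
    rw [WithLp.prod_norm_sq_eq_of_L2]
    change ‖Q j‖ ^ 2 + ‖-t‖ ^ 2 = _
    rw [hQ, norm_neg, Real.norm_eq_abs, sq_abs, ht]
  have hY : ∀ i, ‖Y i‖ ^ 2 = 1 + p / ρ := fun i => by
    rw [WithLp.prod_norm_sq_eq_of_L2]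
    change ‖φ (v i)‖ ^ 2 + ‖s‖ ^ 2 = _
    rw [hφn, Real.norm_eq_abs, sq_abs, hs]
  have hX0 : ∀ j, 0 < ‖X j‖ := fun j => by
    refine (norm_nonneg _).lt_of_ne' fun h => ?_
    have := hX j
    rw [h] at this
    have : 0 < ρ * p := by positivity
    have : (0 : ℝ) ≤ Module.finrank ℝ (K j) := by positivity
    linarith
  have hY0 : ∀ i, 0 < ‖Y i‖ := fun i => by
    refine (norm_nonneg _).lt_of_ne' fun h => ?_
    have := hY i
    rw [h] at this
    have : 0 < p / ρ := by positivity
    linarith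
  have hXY : ∀ j i, ‖X j‖ * ‖Y i‖ ≤ ρ + p := fun j i => by
    rw [← sq_le_sq₀ (by positivity) (by positivity), mul_pow, hX, hY]
    calc (Module.finrank ℝ (K j) + ρ * p) * (1 + p / ρ) ≤ (ρ ^ 2 + ρ * p) * (1 + p / ρ) := by
          rw [hρ2]; gcongr; exact hK j
      _ = (ρ + p) ^ 2 := by field_simp
  have hinner : ∀ j i, inner ℝ (X j) (Y i) = inner ℝ (Q j) (φ (v i)) - p := fun j i => by
    rw [WithLp.prod_inner_apply, ← hts]
    simp only [X, Y, RCLike.inner_apply, conj_trivial]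
    ring
  have hfin : Module.finrank ℝ (WithLp 2 (symmMatrices r × ℝ)) ≤ d := by
    rw [(WithLp.linearEquiv 2 ℝ (symmMatrices r × ℝ)).finrank_eq, Module.finrank_prod,
      Module.finrank_self]
    have := finrank_symmMatrices_le r
    omega
  obtain ⟨L⟩ := exists_linearIsometry_euclideanSpace (WithLp 2 (symmMatrices r × ℝ)) hfin
  have hm : Δ / (2 * (ρ + 1) - Δ) = Δ / 2 / (ρ + p) := by
    rw [hp, div_div]; congr 1; ring
  have hUV : ∀ j i, inner ℝ (‖X j‖⁻¹ • L (X j)) (‖Y i‖⁻¹ • L (Y i)) =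
      inner ℝ (X j) (Y i) / (‖X j‖ * ‖Y i‖) := fun j i => by
    rw [real_inner_smul_left, real_inner_smul_right, L.inner_map_map, div_eq_mul_inv, mul_inv]
    ring
  have hle : ∀ j i, Δ / 2 / (ρ + p) ≤ Δ / 2 / (‖X j‖ * ‖Y i‖) := fun j i =>
    div_le_div_of_nonneg_left (by positivity) (mul_pos (hX0 j) (hY0 i)) (hXY j i)
  refine ⟨fun j => ‖X j‖⁻¹ • L (X j), fun i => ‖Y i‖⁻¹ • L (Y i), fun j => ?_, fun i => ?_, ?_,
    fun j i hji => ?_, fun j i hji => ?_⟩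
  · rw [norm_smul, norm_inv, norm_norm, L.norm_map, inv_mul_cancel₀ (hX0 j).ne']
  · rw [norm_smul, norm_inv, norm_norm, L.norm_map, inv_mul_cancel₀ (hY0 i).ne']
  · rw [hm]; positivity
  · rw [hm, zero_add, hUV, hinner, hin j i hji]
    refine (hle j i).trans (le_of_eq ?_)
    rw [hp]; ring
  · rw [hm, zero_sub, hUV, hinner, le_neg, ← neg_div]
    refine (hle j i).trans (div_le_div_of_nonneg_right ?_ (mul_pos (hX0 j) (hY0 i)).le)
    linarith [hout j i hji]

end Embedding

/-! ### Size of the lifted dimension -/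

section LiftDim

/-- The inequality is `(2r + 1)² ≤ 8d - 7` rewritten; the `+ 1` is room for the threshold
coordinate. -/
theorem choose_liftDim_le {d : ℕ} (hd : 1 ≤ d) : (liftDim d + 1).choose 2 + 1 ≤ d := by
  have hd' : (1 : ℝ) ≤ d := by exact_mod_cast hd
  have h1 : 1 ≤ Real.sqrt (8 * (d : ℝ) - 7) := Real.one_le_sqrt.2 (by linarith)
  have h2 : (liftDim d : ℝ) ≤ (Real.sqrt (8 * (d : ℝ) - 7) - 1) / 2 :=
    Nat.floor_le (by linarith)
  have h3 : (2 * (liftDim d : ℝ) + 1) ^ 2 ≤ 8 * (d : ℝ) - 7 := by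
    rw [← Real.sq_sqrt (show (0 : ℝ) ≤ 8 * d - 7 by linarith)]
    exact pow_le_pow_left₀ (by positivity) (by linarith) 2
  have h5 : (((liftDim d + 1).choose 2 : ℕ) : ℝ) = (liftDim d + 1) * liftDim d / 2 := by
    rw [Nat.cast_choose_two]; push_cast; ring
  have h6 : (((liftDim d + 1).choose 2 + 1 : ℕ) : ℝ) ≤ d := by
    rw [Nat.cast_add, h5]; push_cast; nlinarith
  exact_mod_cast h6

theorem le_liftDim {m d : ℕ} (h : (2 * (m : ℝ) + 1) ^ 2 ≤ 8 * (d : ℝ) - 7) : m ≤ liftDim d := by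
  refine Nat.le_floor ?_
  have := Real.le_sqrt_of_sq_le h
  linarith

theorem abs_liftDim_sub_le {d : ℕ} (hd : 1 ≤ d) :
    |(liftDim d : ℝ) - Real.sqrt (2 * d)| ≤ 5 := by
  have hd' : (1 : ℝ) ≤ d := by exact_mod_cast hd
  set s := Real.sqrt (8 * (d : ℝ) - 7) with hs
  set t := Real.sqrt (2 * (d : ℝ)) with ht
  have hs1 : 1 ≤ s := Real.one_le_sqrt.2 (by linarith)
  have ht0 : 0 ≤ t := Real.sqrt_nonneg _
  have hs2 : s ^ 2 = 8 * d - 7 := Real.sq_sqrt (by linarith)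
  have ht2 : t ^ 2 = 2 * d := Real.sq_sqrt (by linarith)
  have hst : s ≤ 2 * t := by nlinarith
  have hts : 2 * t ≤ s + 7 := by nlinarith
  have h1 : (liftDim d : ℝ) ≤ (s - 1) / 2 := Nat.floor_le (by linarith)
  have h2 : (s - 1) / 2 < (liftDim d : ℝ) + 1 := Nat.lt_floor_add_one _
  rw [abs_le]
  constructor <;> linarith

end LiftDim

/-! ### Margin bounds -/

section Margin

/-- The sets of columns relevant to some row of `A`. -/
def rowSupports {N n : ℕ} (A : Matrix (Fin N) (Fin n) (Fin 2)) : Finset (Finset (Fin n)) :=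
  Finset.univ.image fun j => Finset.univ.filter fun i => A j i = 1

theorem card_rowSupports_le {N n : ℕ} (A : Matrix (Fin N) (Fin n) (Fin 2)) :
    (rowSupports A).card ≤ N :=
  Finset.card_image_le.trans_eq (Finset.card_fin N)

theorem card_rowSupports_le_pow {N n k : ℕ} {A : Matrix (Fin N) (Fin n) (Fin 2)}
    (hA : HasRowWeight A k) : (rowSupports A).card ≤ n ^ k := by
  have : rowSupports A ⊆ Finset.powersetCard k Finset.univ := by
    intro S hS
    obtain ⟨j, -, rfl⟩ := Finset.mem_image.1 hS
    exact Finset.mem_powersetCard_univ.2 (hA j)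
  refine (Finset.card_le_card this).trans ?_
  rw [Finset.card_powersetCard, Finset.card_fin]
  exact Nat.choose_le_pow n k

theorem le_restrictedMargin {N n d k : ℕ} (hk : 0 < k) (hd : 1 ≤ d) (hkr : k < liftDim d)
    {A : Matrix (Fin N) (Fin n) (Fin 2)} (hA : HasRowWeight A k) {M : ℝ} (hM : 1 ≤ M)
    (hAM : (rowSupports A).card * ((n : ℝ) - k) ≤ M) {Δ : ℝ} (h0 : 0 < Δ) (h1 : Δ ≤ 1)
    (hΔ : Δ ≤ 1 / 4 * (((liftDim d : ℝ) - k) / liftDim d *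
      (1 / M) ^ (2 / ((liftDim d : ℝ) - k)))) :
    ((Δ / (2 * (Real.sqrt k + 1) - Δ) : ℝ) : EReal) ≤ restrictedMargin d A := by
  obtain ⟨q, hq⟩ := Nat.exists_eq_add_of_lt hkr
  have hq1 : (liftDim d : ℝ) = k + ((q + 1 : ℕ) : ℝ) := by rw [hq]; push_cast; ring
  obtain ⟨v, hv, hfar⟩ := exists_unit_vectors_far_from_spans
    (E := EuclideanSpace ℝ (Fin (liftDim d))) (n := n) (q := q + 1) hk q.succ_pos
    (by rw [finrank_euclideanSpace_fin, hq]; rfl) (rowSupports A)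
    (fun S hS => by obtain ⟨j, -, rfl⟩ := Finset.mem_image.1 hS; exact hA j) hM hAM
  rw [hq1, add_sub_cancel_left] at hΔ
  obtain ⟨U, V, hUV⟩ := exists_marginEmbedding (choose_liftDim_le hd) hk A hA hv h0 h1
    (fun j i hji c => hΔ.trans (hfar _ (Finset.mem_image_of_mem _ (Finset.mem_univ j)) i
      (by simp [hji]) c))
  exact le_sSup ⟨_, rfl, U, V, hUV⟩

theorem margin_bound {k n N d : ℕ} (hk : 2 ≤ k) (hkn : k < n) (hN : 1 ≤ N)
    (hd : ((k : ℝ) ^ 2 + 5 * k + 7) / 2 ≤ (d : ℝ)) :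
    0 < gapRate k n N d ∧ gapRate k n N d ≤ 1 ∧
      ∀ A : Matrix (Fin N) (Fin n) (Fin 2), HasRowWeight A k →
        ((1 / 4 * gapRate k n N d / (2 * (Real.sqrt k + 1) - 1 / 4 * gapRate k n N d) : ℝ) :
          EReal) ≤ restrictedMargin d A := by
  have hd1 : 1 ≤ d := by
    have : (1 : ℝ) ≤ d := by nlinarith [sq_nonneg (k : ℝ), (Nat.cast_nonneg k : (0 : ℝ) ≤ k)]
    exact_mod_cast this
  have hk0 : (0 : ℝ) ≤ k := Nat.cast_nonneg k
  have hkr : k < liftDim d := le_liftDim (m := k + 1) (by push_cast; nlinarith)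
  have hkr' : (k : ℝ) < liftDim d := by exact_mod_cast hkr
  have hkn' : (1 : ℝ) ≤ n - k := by
    have : (k : ℝ) + 1 ≤ n := by exact_mod_cast hkn
    linarith
  have hN' : (1 : ℝ) ≤ N := by exact_mod_cast hN
  have hM : 1 ≤ ((n : ℝ) - k) * N := one_le_mul_of_one_le_of_one_le hkn' hN'
  have hr0 : (0 : ℝ) < liftDim d := (Nat.cast_nonneg k).trans_lt hkr'
  have hq0 : (0 : ℝ) < liftDim d - k := sub_pos.2 hkr'
  have hpos : 0 < gapRate k n N d :=
    mul_pos (div_pos hq0 hr0) (Real.rpow_pos_of_pos (by positivity) _)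
  have hle : gapRate k n N d ≤ 1 :=
    mul_le_one₀ ((div_le_one hr0).2 (by simp)) (by positivity)
      (Real.rpow_le_one (by positivity) ((div_le_one (by positivity)).2 hM) (by positivity))
  refine ⟨hpos, hle, fun A hA => ?_⟩
  refine le_restrictedMargin (by omega) hd1 hkr hA hM ?_ (by positivity) (by linarith) le_rfl
  rw [mul_comm]
  gcongr
  exact card_rowSupports_le A

theorem polynomial_loss {ε : ℝ} (hε : 0 < ε) {k n N d : ℕ} (hk : 2 ≤ k) (hkn : k < n)
    (hd : (7 + 3 / ε) ^ 2 / 2 * (k : ℝ) ^ 2 ≤ (d : ℝ)) {A : Matrix (Fin N) (Fin n) (Fin 2)}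
    (hA : HasRowWeight A k) :
    ((1 / 32 * (n : ℝ) ^ (-ε) / Real.sqrt k : ℝ) : EReal) ≤ restrictedMargin d A := by
  have hk' : (2 : ℝ) ≤ k := by exact_mod_cast hk
  have hn1 : (1 : ℝ) ≤ n := by exact_mod_cast (by omega : 1 ≤ n)
  have hε3 : 0 < 3 / ε := by positivity
  have hsq : (7 + 3 / ε) * k ≤ Real.sqrt (2 * d) := Real.le_sqrt_of_sq_le (by linarith)
  have hd1 : 1 ≤ d := by
    have : (0 : ℝ) < d := lt_of_lt_of_le (by positivity) hd
    exact_mod_cast this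
  have habs := (abs_le.1 (abs_liftDim_sub_le hd1)).1
  set r : ℝ := ((liftDim d : ℕ) : ℝ) with hr
  -- The 7 in `7 + 3/ε` pays for the subtracted `k`, for the error 5 (at most `5k`) and for the
  -- remaining `1 · k`.
  have hrk : (1 + 3 / ε) * k ≤ r - k := by nlinarith
  have hkr' : (k : ℝ) ≤ r - k := by nlinarith
  have hkr : k < liftDim d := by
    have : (k : ℝ) < r := by linarith
    rw [hr] at this
    exact_mod_cast this
  have hq0 : 0 < r - k := by linarith
  have hn0 : (0 : ℝ) < n := by linarith
  set x : ℝ := (n : ℝ) ^ (-ε)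
  have hx0 : 0 < x := Real.rpow_pos_of_pos hn0 _
  have hx1 : x ≤ 1 := Real.rpow_le_one_of_one_le_of_nonpos hn1 (by linarith)
  have hρ : 1 ≤ Real.sqrt k := Real.one_le_sqrt.2 (by linarith)
  have key : ((1 / 8 * x / (2 * (Real.sqrt k + 1) - 1 / 8 * x) : ℝ) : EReal) ≤
      restrictedMargin d A := by
    refine le_restrictedMargin (M := (n : ℝ) ^ (k + 1)) (by omega) hd1 hkr hA (one_le_pow₀ hn1) ?_
      (by positivity) (by linarith) ?_
    · rw [pow_succ]
      have h1 : ((rowSupports A).card : ℝ) ≤ (n : ℝ) ^ k := by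
        exact_mod_cast card_rowSupports_le_pow hA
      have h2 : (n : ℝ) - k ≤ n := by linarith
      have h3 : (0 : ℝ) ≤ n - k := by
        have : (k : ℝ) ≤ n := by exact_mod_cast hkn.le
        linarith
      gcongr
    · rw [← hr]
      have h1 : (1 : ℝ) / 2 ≤ (r - k) / r := by
        rw [div_le_div_iff₀ (by norm_num) (by linarith)]; linarith
      have h2 : x ≤ (1 / (n : ℝ) ^ (k + 1)) ^ (2 / (r - k)) := by
        rw [one_div, ← Real.rpow_natCast, ← Real.rpow_neg hn0.le, ← Real.rpow_mul hn0.le]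
        refine Real.rpow_le_rpow_of_exponent_le hn1 ?_
        rw [neg_mul, neg_le_neg_iff, mul_div_assoc', div_le_iff₀ hq0]
        -- The goal is `2(k + 1) ≤ ε(r - k)`; here `3k ≥ 2(k + 1)` because `k ≥ 2`.
        have h3 : ε * ((1 + 3 / ε) * k) = ε * k + 3 * k := by field_simp
        have h4 := mul_le_mul_of_nonneg_left hrk hε.le
        push_cast
        nlinarith
      nlinarith [mul_le_mul h1 h2 hx0.le (by linarith)]
  refine le_trans ?_ key
  -- The denominator is at most `4√k`, which turns `1/8` into `1/32`.
  rw [EReal.coe_le_coe_iff, div_le_div_iff₀ (by linarith) (by linarith)]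
  nlinarith

end Margin

theorem mainTheorem3 :
    -- the margin bound, with absolute constants in `Δ = Θ(…)`
    (∃ c C : ℝ, 0 < c ∧ 0 < C ∧
      ∀ k n N d : ℕ, 2 ≤ k → k < n → 1 ≤ N →
        ((k : ℝ) ^ 2 + 5 * k + 7) / 2 ≤ (d : ℝ) →
        ∃ Δ : ℝ, c * gapRate k n N d ≤ Δ ∧ Δ ≤ C * gapRate k n N d ∧ 0 < Δ ∧ Δ ≤ 1 ∧
          ∀ A : Matrix (Fin N) (Fin n) (Fin 2), HasRowWeight A k →
            ((Δ / (2 * (Real.sqrt k + 1) - Δ) : ℝ) : EReal) ≤ restrictedMargin d A) ∧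
    -- `r = √(2d) + O(1)`
    (∃ K : ℝ, ∀ d : ℕ, 1 ≤ d → |(liftDim d : ℝ) - Real.sqrt (2 * d)| ≤ K) ∧
    -- any inverse polynomial loss in dimension `Θ(k²)`
    (∀ ε : ℝ, 0 < ε → ∃ c C : ℝ, 0 < c ∧ 0 < C ∧
      ∀ k n N d : ℕ, 2 ≤ k → k < n → C * (k : ℝ) ^ 2 ≤ (d : ℝ) →
        ∀ A : Matrix (Fin N) (Fin n) (Fin 2), HasRowWeight A k →
          ((c * (n : ℝ) ^ (-ε) / Real.sqrt k : ℝ) : EReal) ≤ restrictedMargin d A) := by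
 
  refine ⟨⟨1 / 4, 1 / 4, by norm_num, by norm_num, fun k n N d hk hkn hN hd => ?_⟩,
    ⟨5, fun d hd => abs_liftDim_sub_le hd⟩,
    fun ε hε => ⟨1 / 32, (7 + 3 / ε) ^ 2 / 2, by norm_num, by positivity,
      fun k n N d hk hkn hd A hA => polynomial_loss hε hk hkn hd hA⟩⟩
  obtain ⟨hpos, hle, h⟩ := margin_bound hk hkn hN hd
  exact ⟨1 / 4 * gapRate k n N d, le_rfl, le_rfl, by positivity, by linarith, h⟩
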